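/- Let $n\in\mathbb N_0$ and let $M,N$ be oriented paracompact smooth Hausdorff manifolds of dimension $n$; put $I=(0,1]$. Let $\Omega^n_c(M)$ be the space of compactly supported smooth $n$-forms on $M$ with its usual (LF-)topology, and let $\hat{\mathcal A}_0(M)=\{\omega\in\Omega^n_c(M) : \int_M\omega=1\}$. A map $\Phi\colon I\times M\to\Omega^n_c(M)$ is called smooth if it maps smooth curves in $I\times M$ to smooth curves in $\Omega^n_c(M)$. For a smooth vector field $X$ on $M$ with local flow $\mathrm{Fl}^X$ put $(\mathrm L_X\Phi)(\varepsilon,p)=\mathrm L_X(\Phi(\varepsilon,p))$ (the usual Lie derivative of $n$-forms) and $(\mathrm L'_X\Phi)(\varepsilon,p)=\frac{\mathrm d}{\mathrm dt}\big|_{t=0}\Phi(\varepsilon,\mathrm{Fl}^X_t p)$. A smooth map $\Phi\colon I\times M\to\hat{\mathcal A}_0(M)$ is called a smoothing kernel, $\Phi\in\hat{\mathcal S}_0(M)$, if for every smooth Riemannian metric $g$ on $M$ and every compact $K\subseteq M$: (i) there are $\varepsilon_0>0$ and $C>0$ such that $\operatorname{supp}\Phi(\varepsilon,p)\subseteq B^g_{\varepsilon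 C}(p)$ (the open metric ball) for all $p\in K$ and all $\varepsilon\in I$ with $\varepsilon\le\varepsilon_0$; (ii) for all $l,m\in\mathbb N_0$ and all smooth vector fields $\zeta_1,\dots,\zeta_l,\theta_1,\dots,\theta_m$ on $M$, $$\big\|\big(\mathrm L_{\theta_1}\cdots\mathrm L_{\theta_m}(\mathrm L'_{\zeta_1}+\mathrm L_{\zeta_1})\cdots(\mathrm L'_{\zeta_l}+\mathrm L_{\zeta_l})\Phi\big)(\varepsilon,p)(q)\big\|_g=O(\varepsilon^{-n-m})\qquad(\varepsilon\to0)$$ uniformly for $p\in K$ and $q\in M$. For $k\ge1$ let $\hat{\mathcal S}_k(M)$ be the set of all $\Phi\in\hat{\mathcal S}_0(M)$ such that for every $f\in C^\infty(M)$ and every compact $K\subseteq M$, $\big|f(p)-\int_M f\,\Phi(\varepsilon,p)\big|=O(\varepsilon^{k+1})$ as $\varepsilon\to0$, uniformly for $p\in K$. **Proposition.** Let $\mu\colon M\to N$ be an orientation-preserving diffeomorphism, $k\in\mathbb N_0$ and $\Phi\in\hat{\mathcal S}_k(N)$. Then the map $\Psi\colon I\times M\to\Omega^n_c(M)$ defined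 by $\Psi(\varepsilon,p)=\mu^*(\Phi(\varepsilon,\mu(p)))$ belongs to $\hat{\mathcal S}_k(M)$. -/

import Mathlib

open scoped Manifold ContDiff Topology

noncomputable section

namespace SmoothingKernels

/-- The model space `ℝⁿ`. -/
abbrev Model (n : ℕ) : Type := EuclideanSpace ℝ (Fin n)

section Forms

variable (n : ℕ) (M : Type*) [TopologicalSpace M] [ChartedSpace (Model n) M]

/-- Arbitrary (not necessarily continuous) sections of `Λⁿ T*M`. -/
abbrev TopForm : Type _ :=
  ∀ q : M, TangentSpace (𝓡 n) q [⋀^Fin n]→L[ℝ] ℝ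

/-- Smooth vector fields on `M`. -/
abbrev VField [IsManifold (𝓡 n) ∞ M] : Type _ :=
  ContMDiffSection (𝓡 n) (Model n) ∞ (fun q : M => TangentSpace (𝓡 n) q)

variable {n M}

/-- The coordinate frame `∂₁, …, ∂ₙ` of the chart `e` at the point with coordinates `x`. -/
def frame (e : OpenPartialHomeomorph M (Model n)) (x : Model n) :
    Fin n → TangentSpace (𝓡 n) (e.symm x) :=
  fun i => mfderiv (𝓡 n) (𝓡 n) e.symm x (EuclideanSpace.single i (1 : ℝ) : Model n)

/-- The coefficient `a` of the local expression `a dx¹ ∧ ⋯ ∧ dxⁿ` of `η` in the chart `e`. -/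
def coeff (e : OpenPartialHomeomorph M (Model n)) (η : TopForm n M) (x : Model n) : ℝ :=
  η (e.symm x) (frame e x)

/-- `η` is a smooth `n`-form: its coefficient is smooth in every chart of the smooth structure. -/
def IsSmoothForm (η : TopForm n M) : Prop :=
  ∀ e ∈ IsManifold.maximalAtlas (𝓡 n) ∞ M, ContDiffOn ℝ ∞ (coeff e η) e.target

/-- The (closed) support of an `n`-form. -/
def supp (η : TopForm n M) : Set M := closure {q | η q ≠ 0}

variable (n M)

/-- `Ωⁿ_c(M)`: smooth compactly supported `n`-forms. -/
def CForm : Submodule ℝ (TopForm n M) where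
  carrier := {η | IsSmoothForm η ∧ IsCompact (supp η)}
  zero_mem' := by
    refine ⟨fun e _ => ?_, by simp [supp]⟩
    have : coeff e (0 : TopForm n M) = fun _ => 0 := by ext x; simp [coeff]
    rw [this]; exact contDiffOn_const
  add_mem' := by
    rintro a b ⟨ha, hK⟩ ⟨hb, hL⟩
    refine ⟨fun e he => ?_, (hK.union hL).of_isClosed_subset isClosed_closure ?_⟩
    · have : coeff e (a + b) = fun x => coeff e a x + coeff e b x := by ext x; simp [coeff]
      rw [this]; exact (ha e he).add (hb e he)
    · refine closure_minimal (fun q hq => ?_) (isClosed_closure.union isClosed_closure)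
      by_cases h : a q = 0
      · exact Or.inr (subset_closure fun h' => hq (by simp [h, h']))
      · exact Or.inl (subset_closure h)
  smul_mem' := by
    rintro c a ⟨ha, hK⟩
    refine ⟨fun e he => ?_, hK.of_isClosed_subset isClosed_closure ?_⟩
    · have : coeff e (c • a) = fun x => c * coeff e a x := by ext x; simp [coeff]
      rw [this]; exact contDiffOn_const.mul (ha e he)
    · exact closure_mono fun q hq h => hq (by simp [h])

end Forms

section Orientation

variable {n : ℕ} {M : Type*} [TopologicalSpace M] [ChartedSpace (Model n) M]

/-- The sign (`1` or `-1`) of the coordinate frame of `e` with respect to orientations of the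
tangent spaces. -/
def frameSign (o : ∀ q : M, Orientation ℝ (TangentSpace (𝓡 n) q) (Fin n))
    (e : OpenPartialHomeomorph M (Model n)) (x : Model n) : ℝ :=
  (SignType.sign ((o (e.symm x)).someVector (frame e x)) : ℝ)

variable (n M)

/-- An orientation of the manifold `M`: an orientation of every tangent space, depending
continuously on the point, i.e. coordinate frames have locally constant sign. -/
structure MOrientation where
  at' : ∀ q : M, Orientation ℝ (TangentSpace (𝓡 n) q) (Fin n)
  continuousOn : ∀ e ∈ IsManifold.maximalAtlas (𝓡 n) ∞ M,
    ContinuousOn (frameSign at' e) e.target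

variable {n M}

/-- `s` is the integral of the `n`-form `η` over the oriented manifold: `η` is a finite sum of
smooth forms, each compactly supported in a chart domain, and `s` is the sum of the corresponding
integrals in coordinates, taken with the sign of the chart. -/
def HasIntegral (o : MOrientation n M) (η : TopForm n M) (s : ℝ) : Prop :=
  ∃ (m : ℕ) (α : Fin m → CForm n M) (e : Fin m → OpenPartialHomeomorph M (Model n)),
    (∀ j, e j ∈ IsManifold.maximalAtlas (𝓡 n) ∞ M ∧ supp (α j : TopForm n M) ⊆ (e j).source) ∧
    η = ∑ j, (α j : TopForm n M) ∧
    s = ∑ j, ∫ x in (e j).target, frameSign o.at' (e j) x * coeff (e j) (α j : TopForm n M) x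

open Classical in
/-- The integral `∫_M η` (of a smooth compactly supported `n`-form `η`). -/
def integral (o : MOrientation n M) (η : TopForm n M) : ℝ :=
  if h : ∃ s, HasIntegral o η s then h.choose else 0

/-- `Â₀(M)`: smooth compactly supported `n`-forms with integral one. -/
def unitForms (o : MOrientation n M) : Set (CForm n M) :=
  {η | integral o (η : TopForm n M) = 1}

end Orientation

section Smoothness

variable {n : ℕ} {M : Type*} [TopologicalSpace M] [ChartedSpace (Model n) M]

/-- Continuity of a seminorm for the usual (LF-)topology of `Ωⁿ_c(M)`, the locally convex inductive
limit of the spaces of forms supported in a fixed compact set `K`: the restriction of the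
seminorm to each of these is dominated by finitely many of the seminorms
`sup_{x ∈ L} ‖Dʲ (coeff e η) x‖`, with `e` a chart, `L ⊆ e.target` compact and `j ∈ ℕ`. -/
def IsContinuousSeminorm (p : Seminorm ℝ (CForm n M)) : Prop :=
  ∀ K : Set M, IsCompact K →
    ∃ (m : ℕ) (e : Fin m → OpenPartialHomeomorph M (Model n)) (L : Fin m → Set (Model n))
      (j : Fin m → ℕ) (C : ℝ),
      (∀ i, e i ∈ IsManifold.maximalAtlas (𝓡 n) ∞ M ∧ IsCompact (L i) ∧ L i ⊆ (e i).target) ∧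
      ∀ (η : CForm n M) (r : ℝ), supp (η : TopForm n M) ⊆ K → 0 ≤ r →
        (∀ i, ∀ x ∈ L i, ‖iteratedFDeriv ℝ (j i) (coeff (e i) (η : TopForm n M)) x‖ ≤ r) →
        p η ≤ C * r

/-- The curve `c` in `Ωⁿ_c(M)` has derivative `v` at `t`, in the topology of `Ωⁿ_c(M)`. -/
def HasCurveDerivAt (c : ℝ → CForm n M) (v : CForm n M) (t : ℝ) : Prop :=
  ∀ p : Seminorm ℝ (CForm n M), IsContinuousSeminorm p →
    Filter.Tendsto (fun h : ℝ => p (h⁻¹ • (c (t + h) - c t) - v)) (𝓝[≠] 0) (𝓝 0)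

/-- `c` is a smooth curve in the locally convex space `Ωⁿ_c(M)`: all its iterated derivatives
exist. -/
def IsSmoothCurve (c : ℝ → CForm n M) : Prop :=
  ∃ d : ℕ → ℝ → CForm n M, d 0 = c ∧ ∀ k t, HasCurveDerivAt (d k) (d (k + 1) t) t

variable (n M)

/-- Maps `I × M → Ωⁿ_c(M)`, where `I = (0, 1]`. -/
abbrev KernelMap : Type _ := Set.Ioc (0 : ℝ) 1 → M → CForm n M

variable {n M}

/-- `Φ ∈ C^∞(I × M, Ωⁿ_c(M))` in the sense of convenient calculus: `Φ` maps smooth curves in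
`I × M` to smooth curves in `Ωⁿ_c(M)`. -/
def IsSmoothKernelMap (Φ : KernelMap n M) : Prop :=
  ∀ (a : ℝ → Set.Ioc (0 : ℝ) 1) (γ : ℝ → M),
    ContDiff ℝ ∞ (fun t => (a t : ℝ)) → ContMDiff 𝓘(ℝ, ℝ) (𝓡 n) ∞ γ →
      IsSmoothCurve fun t => Φ (a t) (γ t)

end Smoothness

section Lie

variable {n : ℕ} {M : Type*} [TopologicalSpace M] [ChartedSpace (Model n) M]

/-- `F` is a smooth local flow of `X` near `q`: on some `(-δ, δ) × U` with `U` an open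
neighbourhood of `q`, `F` is smooth and `t ↦ F t p` is the integral curve of `X` through `p`. -/
def IsLocalFlow [IsManifold (𝓡 n) ∞ M] (X : VField n M) (q : M) (F : ℝ → M → M) : Prop :=
  ∃ (δ : ℝ) (U : Set M), 0 < δ ∧ IsOpen U ∧ q ∈ U ∧
    ContMDiffOn (𝓘(ℝ, ℝ).prod (𝓡 n)) (𝓡 n) ∞ (fun z : ℝ × M => F z.1 z.2)
      (Set.Ioo (-δ) δ ×ˢ U) ∧
    ∀ p ∈ U, F 0 p = p ∧
      IsMIntegralCurveOn (I := 𝓡 n) (fun t => F t p) (fun x => X x) (Set.Ioo (-δ) δ)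

open Classical in
/-- The local flow `(t, p) ↦ Fl^X_t p` for `(t, p)` near `(0, q)`. -/
def localFlow [IsManifold (𝓡 n) ∞ M] (X : VField n M) (q : M) : ℝ → M → M :=
  if h : ∃ F, IsLocalFlow X q F then h.choose else fun _ p => p

/-- Pullback of an `n`-form by a map: `(f^*η)_p = η_{f p} ∘ (T_p f × ⋯ × T_p f)`. -/
def pullback {N : Type*} [TopologicalSpace N] [ChartedSpace (Model n) N] (f : M → N)
    (η : TopForm n N) : TopForm n M :=
  fun p => (η (f p)).compContinuousLinearMap (mfderiv (𝓡 n) (𝓡 n) f p)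

/-- The Lie derivative `(L_X η)_q = d/dt|_{t=0} ((Fl^X_t)^* η)_q`. -/
def lieDeriv [IsManifold (𝓡 n) ∞ M] (X : VField n M) (η : TopForm n M) : TopForm n M :=
  fun q => deriv (fun t => pullback (localFlow X q t) η q) 0

/-- `L_X` on two-point forms depending on `ε`, `(L_X Φ)(ε, p) = L_X (Φ(ε, p))`. -/
def lieTwo [IsManifold (𝓡 n) ∞ M] (X : VField n M)
    (Φ : Set.Ioc (0 : ℝ) 1 → M → TopForm n M) : Set.Ioc (0 : ℝ) 1 → M → TopForm n M :=
  fun ε p => lieDeriv X (Φ ε p)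

/-- `L'_X` on two-point forms depending on `ε`,
`(L'_X Φ)(ε, p) = d/dt|_{t=0} Φ(ε, Fl^X_t p)`. -/
def lieTwo' [IsManifold (𝓡 n) ∞ M] (X : VField n M)
    (Φ : Set.Ioc (0 : ℝ) 1 → M → TopForm n M) : Set.Ioc (0 : ℝ) 1 → M → TopForm n M :=
  fun ε p q => deriv (fun t => Φ ε (localFlow X p t p) q) 0

/-- `L_{θ₁} ⋯ L_{θₘ} (L'_{ζ₁} + L_{ζ₁}) ⋯ (L'_{ζₗ} + L_{ζₗ}) Φ`. -/
def iterLie [IsManifold (𝓡 n) ∞ M] (θ ζ : List (VField n M))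
    (Φ : Set.Ioc (0 : ℝ) 1 → M → TopForm n M) : Set.Ioc (0 : ℝ) 1 → M → TopForm n M :=
  θ.foldr lieTwo (ζ.foldr (fun X Ψ => lieTwo' X Ψ + lieTwo X Ψ) Φ)

end Lie

section Metric

variable {n : ℕ} {M : Type*} [TopologicalSpace M] [ChartedSpace (Model n) M]
  [IsManifold (𝓡 n) ∞ M]

variable (n M) in
/-- Smooth Riemannian metrics on `M`. -/
abbrev RMetric : Type _ :=
  Bundle.ContMDiffRiemannianMetric (𝓡 n) ∞ (Model n) (fun q : M => TangentSpace (𝓡 n) q)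

/-- The norm of an `n`-covector `α` at `q` with respect to `g`: the supremum of `|α(v₁, …, vₙ)|` over
vectors of `g`-length at most one, which is the value of `|α|` on any `g`-orthonormal basis. -/
def formNorm (g : RMetric n M) {q : M} (α : TangentSpace (𝓡 n) q [⋀^Fin n]→L[ℝ] ℝ) : ℝ :=
  ⨆ v : {v : Fin n → TangentSpace (𝓡 n) q // ∀ i, g.inner q (v i) (v i) ≤ 1}, |α v.1|

open scoped Bundle in
/-- The open metric ball `B^g_r(p)` of the Riemannian distance of `g`. -/
def metricBall (g : RMetric n M) (p : M) (r : ℝ) : Set M :=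
  letI : Bundle.RiemannianBundle (fun x : M => TangentSpace (𝓡 n) x) := ⟨g.toRiemannianMetric⟩
  {q | Manifold.riemannianEDist (𝓡 n) p q < ENNReal.ofReal r}

end Metric

section Kernels

variable {n : ℕ} {M : Type*} [TopologicalSpace M] [ChartedSpace (Model n) M]
  [IsManifold (𝓡 n) ∞ M]

/-- Smoothing kernels on the oriented manifold `M`. -/
structure IsSmoothingKernel (o : MOrientation n M) (Φ : KernelMap n M) : Prop where
  smooth : IsSmoothKernelMap Φ
  mem_unitForms : ∀ ε p, Φ ε p ∈ unitForms o
  supp_subset : ∀ g : RMetric n M, ∀ K : Set M, IsCompact K →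
    ∃ ε₀ > (0 : ℝ), ∃ C > (0 : ℝ), ∀ p ∈ K, ∀ ε : Set.Ioc (0 : ℝ) 1, (ε : ℝ) ≤ ε₀ →
      supp (Φ ε p : TopForm n M) ⊆ metricBall g p ((ε : ℝ) * C)
  growth : ∀ g : RMetric n M, ∀ K : Set M, IsCompact K → ∀ θ ζ : List (VField n M),
    ∃ ε₀ > (0 : ℝ), ∃ C > (0 : ℝ), ∀ ε : Set.Ioc (0 : ℝ) 1, (ε : ℝ) ≤ ε₀ → ∀ p ∈ K, ∀ q : M,
      formNorm g (iterLie θ ζ (fun ε p => (Φ ε p : TopForm n M)) ε p q) ≤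
        C / (ε : ℝ) ^ (n + θ.length)

/-- `Ŝ_k(M)`: for `k = 0` all smoothing kernels, for `k ≥ 1` those smoothing kernels which
approximate smooth functions to order `k + 1`. -/
def kernelSpace (o : MOrientation n M) (k : ℕ) : Set (KernelMap n M) :=
  {Φ | IsSmoothingKernel o Φ ∧ (1 ≤ k →
    ∀ f : M → ℝ, ContMDiff (𝓡 n) 𝓘(ℝ, ℝ) ∞ f → ∀ K : Set M, IsCompact K →
      ∃ ε₀ > (0 : ℝ), ∃ C > (0 : ℝ), ∀ ε : Set.Ioc (0 : ℝ) 1, (ε : ℝ) ≤ ε₀ → ∀ p ∈ K,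
        |f p - integral o (fun q => f q • (Φ ε p : TopForm n M) q)| ≤ C * (ε : ℝ) ^ (k + 1))}

end Kernels

section Diffeo

variable {n : ℕ} {M N : Type*} [TopologicalSpace M] [ChartedSpace (Model n) M]
  [IsManifold (𝓡 n) ∞ M] [TopologicalSpace N] [ChartedSpace (Model n) N] [IsManifold (𝓡 n) ∞ N]

/-- `μ` maps the orientation of `M` to the one of `N`. -/
def OrientationPreserving (oM : MOrientation n M) (oN : MOrientation n N)
    (μ : M ≃ₘ^∞⟮𝓡 n, 𝓡 n⟯ N) : Prop :=
  ∀ p : M, Orientation.map (Fin n)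
    (μ.mfderivToContinuousLinearEquiv (by simp) p).toLinearEquiv (oM.at' p) = oN.at' (μ p)

/-- Transport of a chart by a diffeomorphism. -/
def transportChart (μ : M ≃ₘ^∞⟮𝓡 n, 𝓡 n⟯ N) (e : OpenPartialHomeomorph M (Model n)) :
    OpenPartialHomeomorph N (Model n) :=
  μ.symm.toHomeomorph.toOpenPartialHomeomorph.trans e

theorem transportChart_mem (μ : M ≃ₘ^∞⟮𝓡 n, 𝓡 n⟯ N) {e : OpenPartialHomeomorph M (Model n)}
    (he : e ∈ IsManifold.maximalAtlas (𝓡 n) ∞ M) :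
    transportChart μ e ∈ IsManifold.maximalAtlas (𝓡 n) ∞ N := by
  have h1 := contMDiffOn_of_mem_maximalAtlas he
  have h2 := contMDiffOn_symm_of_mem_maximalAtlas he
  refine OpenPartialHomeomorph.mem_maximalAtlas_of_contMDiffOn _ ?_ ?_
  · exact h1.comp μ.symm.contMDiff.contMDiffOn fun x hx => hx.2
  · exact μ.contMDiff.comp_contMDiffOn (h2.mono fun x hx => hx.1)

theorem coeff_pullback (μ : M ≃ₘ^∞⟮𝓡 n, 𝓡 n⟯ N) {e : OpenPartialHomeomorph M (Model n)}
    (he : e ∈ IsManifold.maximalAtlas (𝓡 n) ∞ M) (η : TopForm n N) {x : Model n}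
    (hx : x ∈ e.target) :
    coeff e (pullback μ η) x = coeff (transportChart μ e) η x := by
  have h2 : MDifferentiableAt (𝓡 n) (𝓡 n) e.symm x :=
    (contMDiffAt_symm_of_mem_maximalAtlas he hx).mdifferentiableAt (by simp)
  have hμ : MDifferentiableAt (𝓡 n) (𝓡 n) μ (e.symm x) :=
    μ.contMDiff.mdifferentiable (by simp) _
  have hc : mfderiv (𝓡 n) (𝓡 n) (μ ∘ e.symm) x
      = (mfderiv (𝓡 n) (𝓡 n) μ (e.symm x)).comp (mfderiv (𝓡 n) (𝓡 n) e.symm x) :=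
    mfderiv_comp x hμ h2
  change η (μ (e.symm x)) _ = η (μ (e.symm x)) _
  congr 1
  funext i
  exact (congrArg (fun L => L (EuclideanSpace.single i (1 : ℝ) : Model n)) hc).symm

/-- The pullback `μ^* : Ωⁿ_c(N) → Ωⁿ_c(M)` by a diffeomorphism. -/
def pullbackC (μ : M ≃ₘ^∞⟮𝓡 n, 𝓡 n⟯ N) (η : CForm n N) : CForm n M :=
  ⟨pullback μ (η : TopForm n N), by
    refine ⟨fun e he => ?_, ?_⟩
    · refine ((η.2.1 _ (transportChart_mem μ he)).mono ?_).congr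
        fun x hx => coeff_pullback μ he _ hx
      intro x hx
      exact ⟨hx, trivial⟩
    · have h : IsCompact (μ ⁻¹' supp (η : TopForm n N)) :=
        μ.toHomeomorph.isCompact_preimage.2 η.2.2
      refine h.of_isClosed_subset isClosed_closure ?_
      refine closure_minimal (fun q hq => subset_closure fun h0 => hq ?_)
        (isClosed_closure.preimage μ.continuous)
      ext v
      simp [pullback, h0]⟩

end Diffeo

end SmoothingKernels

end

/-!
Every datum entering the definition of a smoothing kernel is natural under diffeomorphisms, so a
diffeomorphism `μ : M → N` carries kernels on `N` to kernels on `M`. The content of the proof is the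
naturality of the individual data.

* Integral: transporting charts by `μ` matches the decompositions of `η` into forms supported in
  chart domains with those of `μ^*η`, and the coefficients and the chart signs agree. Hence both
  forms have the same values of the integral (`integral_pullback`). Applied to `f Φ(ε, μ p)`, this
  also gives the approximation property of order `k + 1`, with `f ∘ μ⁻¹` as test function.
* Smooth curves: continuous seminorms of `Ωⁿ_c(M)` pull back to continuous seminorms of `Ωⁿ_c(N)`
  (`IsContinuousSeminorm.comp_pullback`), so `μ^*` preserves derivatives of curves.
* Lie derivatives: `μ` maps a local flow of `X` to a local flow of the push-forward of `X`, and
  local flows have unique germs because integral curves are unique (`VRelated.localFlow`). Both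
  `L_X` and `L'_X` therefore commute with the transport of two-point forms (`iterLie_pullTwo`).
* Metrics: a metric `g` on `M` is isometric to `(μ⁻¹)^*g` on `N` (`pullbackMetric`). The pointwise
  norms of forms correspond (`formNorm_pullback`), and so do metric balls, since the lengths of
  curves are preserved (`preimage_metricBall_subset`).

The bounds for `μ^*Φ` over `K ⊆ M` with respect to `g` are thus the bounds for `Φ` over `μ(K)` with
respect to `(μ⁻¹)^*g`.
-/

open scoped Manifold ContDiff Topology

noncomputable section

namespace SmoothingKernels

/-! ### Pullback of forms and transport of charts -/

section Pullback

variable {n : ℕ} {M N P : Type*} [TopologicalSpace M] [ChartedSpace (Model n) M]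
  [TopologicalSpace N] [ChartedSpace (Model n) N] [TopologicalSpace P] [ChartedSpace (Model n) P]

theorem pullback_id (η : TopForm n M) : pullback (fun p : M => p) η = η := by
  funext p
  ext v
  have h : mfderiv (𝓡 n) (𝓡 n) (fun p : M => p) p = ContinuousLinearMap.id ℝ _ := mfderiv_id
  simp only [pullback, h]
  rfl

theorem pullback_pullback_apply {f : M → N} {g : N → P} {p : M}
    (hf : MDifferentiableAt (𝓡 n) (𝓡 n) f p) (hg : MDifferentiableAt (𝓡 n) (𝓡 n) g (f p))
    (η : TopForm n P) : pullback f (pullback g η) p = pullback (g ∘ f) η p := by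
  have h := mfderiv_comp p hg hf
  ext v
  simp only [pullback, h]
  rfl

/-- The pullback of a form at `p` depends only on the germ of the map at `p`. -/
theorem pullback_congr {f g : M → N} {p : M} (h : f =ᶠ[𝓝 p] g) (η : TopForm n N) :
    pullback f η p = pullback g η p := by
  have key : ∀ (a b : N) (A B : Model n →L[ℝ] Model n), a = b → A = B →
      ContinuousAlternatingMap.compContinuousLinearMap
        (show Model n [⋀^Fin n]→L[ℝ] ℝ from η a) A =
      ContinuousAlternatingMap.compContinuousLinearMap
        (show Model n [⋀^Fin n]→L[ℝ] ℝ from η b) B := by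
    rintro a _ A _ rfl rfl; rfl
  exact key _ _ _ _ h.eq_of_nhds h.mfderiv_eq

variable (μ : M ≃ₘ^∞⟮𝓡 n, 𝓡 n⟯ N)

theorem pullback_symm_pullback (η : TopForm n N) : pullback μ.symm (pullback μ η) = η := by
  funext p
  rw [pullback_pullback_apply (μ.symm.contMDiff.mdifferentiable (by simp) _)
    (μ.contMDiff.mdifferentiable (by simp) _)]
  have h : μ ∘ μ.symm = fun p : N => p := funext μ.apply_symm_apply
  rw [h, pullback_id]

theorem pullback_sum {ι : Type*} (s : Finset ι) (f : M → N) (α : ι → TopForm n N) :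
    pullback f (∑ j ∈ s, α j) = ∑ j ∈ s, pullback f (α j) := by
  funext p
  ext v
  simp [pullback, Finset.sum_apply, ContinuousAlternatingMap.sum_apply]

/-- Pullback of alternating maps by the tangent map of a diffeomorphism, as an equivalence. -/
def pullbackEquiv (p : M) : (TangentSpace (𝓡 n) (μ p) [⋀^Fin n]→L[ℝ] ℝ) ≃L[ℝ]
    (TangentSpace (𝓡 n) p [⋀^Fin n]→L[ℝ] ℝ) :=
  (μ.mfderivToContinuousLinearEquiv (by simp) p).symm.continuousAlternatingMapCongrLeft

theorem pullbackEquiv_apply (η : TopForm n N) (p : M) :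
    pullbackEquiv μ p (η (μ p)) = pullback μ η p := rfl

theorem pullback_apply_eq_zero_iff (η : TopForm n N) (p : M) :
    pullback μ η p = 0 ↔ η (μ p) = 0 := by
  rw [← pullbackEquiv_apply]
  exact (pullbackEquiv μ p).map_eq_zero_iff

theorem supp_pullback (η : TopForm n N) : supp (pullback μ η) = μ ⁻¹' supp η := by
  have h := μ.toHomeomorph.preimage_closure {q | η q ≠ 0}
  refine Eq.trans ?_ h.symm
  simp only [supp, Ne, pullback_apply_eq_zero_iff]
  rfl

theorem mfderiv_symm_mfderiv (p : M) (v : TangentSpace (𝓡 n) p) :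
    mfderiv (𝓡 n) (𝓡 n) μ.symm (μ p) (mfderiv (𝓡 n) (𝓡 n) μ p v) = v := by
  have h := mfderiv_comp p (μ.symm.contMDiff.mdifferentiable (by simp) (μ p))
    (μ.contMDiff.mdifferentiable (by simp) p)
  have h1 : μ.symm ∘ μ = id := funext μ.symm_apply_apply
  rw [h1, mfderiv_id] at h
  exact (congrArg (fun L => L v) h).symm

theorem deriv_congr_covector {p : M} {c c' : ℝ → TangentSpace (𝓡 n) p [⋀^Fin n]→L[ℝ] ℝ} {t : ℝ}
    (h : c =ᶠ[𝓝 t] c') : deriv c t = deriv c' t :=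
  Filter.EventuallyEq.deriv_eq (F := Model n [⋀^Fin n]→L[ℝ] ℝ) h

/-- Pullback by a diffeomorphism commutes with differentiation of curves of covectors. As the
pullback is a linear equivalence, the curve need not be differentiable. -/
theorem deriv_pullbackEquiv (p : M)
    (c : ℝ → TangentSpace (𝓡 n) (μ p) [⋀^Fin n]→L[ℝ] ℝ) (t : ℝ) :
    deriv (fun s => pullbackEquiv μ p (c s)) t = pullbackEquiv μ p (deriv c t) := by
  have h := (show (Model n [⋀^Fin n]→L[ℝ] ℝ) ≃L[ℝ] (Model n [⋀^Fin n]→L[ℝ] ℝ) from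
    pullbackEquiv μ p).comp_fderiv (f := c) (x := t)
  exact congrArg (fun L => L 1) h

theorem transportChart_target (e : OpenPartialHomeomorph M (Model n)) :
    (transportChart μ e).target = e.target := by
  simp [transportChart]

theorem transportChart_source (e : OpenPartialHomeomorph M (Model n)) :
    (transportChart μ e).source = μ.symm ⁻¹' e.source := by
  simp [transportChart]

theorem transportChart_transportChart_symm (e : OpenPartialHomeomorph N (Model n)) :
    transportChart μ (transportChart μ.symm e) = e := by
  refine OpenPartialHomeomorph.ext _ _ (fun x => ?_) (fun x => ?_) ?_
  · simp [transportChart]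
  · simp [transportChart]
  · ext x
    simp [transportChart]

theorem frame_transportChart {e : OpenPartialHomeomorph M (Model n)}
    (he : e ∈ IsManifold.maximalAtlas (𝓡 n) ∞ M) {x : Model n} (hx : x ∈ e.target) :
    frame (transportChart μ e) x =
      fun i => μ.mfderivToContinuousLinearEquiv (by simp) (e.symm x) (frame e x i) := by
  have h2 : MDifferentiableAt (𝓡 n) (𝓡 n) e.symm x :=
    (contMDiffAt_symm_of_mem_maximalAtlas he hx).mdifferentiableAt (by simp)
  have hμ : MDifferentiableAt (𝓡 n) (𝓡 n) μ (e.symm x) :=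
    μ.contMDiff.mdifferentiable (by simp) _
  have hc : mfderiv (𝓡 n) (𝓡 n) (μ ∘ e.symm) x
      = (mfderiv (𝓡 n) (𝓡 n) μ (e.symm x)).comp (mfderiv (𝓡 n) (𝓡 n) e.symm x) :=
    mfderiv_comp x hμ h2
  funext i
  exact congrArg (fun L => L (EuclideanSpace.single i (1 : ℝ) : Model n)) hc

end Pullback

/-! ### Invariance of the integral -/

section Integral

variable {n : ℕ} {M N : Type*} [TopologicalSpace M] [ChartedSpace (Model n) M]
  [IsManifold (𝓡 n) ∞ M] [TopologicalSpace N] [ChartedSpace (Model n) N] [IsManifold (𝓡 n) ∞ N]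

/-- The sign of an alternating map representing an orientation does not depend on the choice of
the representative. -/
theorem sign_apply_eq_of_sameRay {V : Type*} [AddCommGroup V] [Module ℝ V]
    {a b : V [⋀^Fin n]→ₗ[ℝ] ℝ} (h : SameRay ℝ a b) (ha : a ≠ 0) (hb : b ≠ 0) (v : Fin n → V) :
    SignType.sign (a v) = SignType.sign (b v) := by
  obtain ⟨r, s, hr, hs, h⟩ := h.exists_pos ha hb
  have h1 : SignType.sign (r * a v) = SignType.sign (s * b v) := by
    rw [← smul_eq_mul, ← smul_eq_mul, ← AlternatingMap.smul_apply, h, AlternatingMap.smul_apply]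
  simpa [sign_mul, sign_pos hr, sign_pos hs] using h1

theorem sign_someVector_map {V W : Type*} [AddCommGroup V] [Module ℝ V] [AddCommGroup W]
    [Module ℝ W] (o : Orientation ℝ V (Fin n)) (L : V ≃ₗ[ℝ] W) (v : Fin n → V) :
    SignType.sign ((Orientation.map (Fin n) L o).someVector (fun i => L (v i))) =
      SignType.sign (o.someVector v) := by
  have hne : o.someVector.compLinearMap (L.symm : W →ₗ[ℝ] V) ≠ 0 :=
    mt (AlternatingMap.compLinearEquiv_eq_zero_iff _ _).mp o.someVector_ne_zero
  have h : SameRay ℝ (Orientation.map (Fin n) L o).someVector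
      (o.someVector.compLinearMap (L.symm : W →ₗ[ℝ] V)) := by
    rw [← ray_eq_iff (Module.Ray.someVector_ne_zero _) hne, Module.Ray.someVector_ray]
    conv_lhs => rw [← Module.Ray.someVector_ray o]
    rfl
  rw [sign_apply_eq_of_sameRay h (Module.Ray.someVector_ne_zero _) hne]
  congr 1
  simp [AlternatingMap.compLinearMap_apply]

omit [IsManifold (𝓡 n) ∞ M] [IsManifold (𝓡 n) ∞ N] in
theorem frameSign_transportChart {oM : MOrientation n M} {oN : MOrientation n N}
    {μ : M ≃ₘ^∞⟮𝓡 n, 𝓡 n⟯ N} (hμ : OrientationPreserving oM oN μ)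
    {e : OpenPartialHomeomorph M (Model n)} (he : e ∈ IsManifold.maximalAtlas (𝓡 n) ∞ M)
    {x : Model n} (hx : x ∈ e.target) :
    frameSign oN.at' (transportChart μ e) x = frameSign oM.at' e x := by
  have h1 := sign_someVector_map (oM.at' (e.symm x))
    (μ.mfderivToContinuousLinearEquiv (by simp) (e.symm x)).toLinearEquiv (frame e x)
  rw [hμ] at h1
  rw [frameSign, frameSign, frame_transportChart μ he hx]
  exact congrArg (fun s : SignType => (s : ℝ)) h1

theorem HasIntegral.pullback {oM : MOrientation n M} {oN : MOrientation n N}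
    {μ : M ≃ₘ^∞⟮𝓡 n, 𝓡 n⟯ N} (hμ : OrientationPreserving oM oN μ) {η : TopForm n N} {s : ℝ}
    (h : HasIntegral oN η s) : HasIntegral oM (pullback μ η) s := by
  obtain ⟨m, α, e, he, rfl, rfl⟩ := h
  refine ⟨m, fun j => pullbackC μ (α j), fun j => transportChart μ.symm (e j), fun j => ?_, ?_, ?_⟩
  · refine ⟨transportChart_mem μ.symm (he j).1, ?_⟩
    rw [transportChart_source]
    change supp (SmoothingKernels.pullback μ (α j : TopForm n N)) ⊆ _
    rw [supp_pullback]
    exact Set.preimage_mono (he j).2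
  · exact pullback_sum _ _ _
  · refine Finset.sum_congr rfl fun j _ => ?_
    rw [transportChart_target]
    refine MeasureTheory.setIntegral_congr_fun (e j).open_target.measurableSet fun x hx => ?_
    have hx' : x ∈ (transportChart μ.symm (e j)).target := by rwa [transportChart_target]
    -- The chart transported to `M` and back to `N` is the original one.
    have h1 := frameSign_transportChart hμ (transportChart_mem μ.symm (he j).1) hx'
    have h2 := coeff_pullback μ (transportChart_mem μ.symm (he j).1) (α j : TopForm n N) hx'
    rw [transportChart_transportChart_symm] at h1 h2
    change _ = _ * coeff _ (SmoothingKernels.pullback μ (α j : TopForm n N)) x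
    rw [← h1, h2]

theorem HasIntegral.pullback_symm {oM : MOrientation n M} {oN : MOrientation n N}
    {μ : M ≃ₘ^∞⟮𝓡 n, 𝓡 n⟯ N} (hμ : OrientationPreserving oM oN μ) {η : TopForm n M} {s : ℝ}
    (h : HasIntegral oM η s) : HasIntegral oN (SmoothingKernels.pullback μ.symm η) s := by
  obtain ⟨m, α, e, he, rfl, rfl⟩ := h
  refine ⟨m, fun j => pullbackC μ.symm (α j), fun j => transportChart μ (e j), fun j => ?_, ?_, ?_⟩
  · refine ⟨transportChart_mem μ (he j).1, ?_⟩
    rw [transportChart_source]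
    change supp (SmoothingKernels.pullback μ.symm (α j : TopForm n M)) ⊆ _
    rw [supp_pullback]
    exact Set.preimage_mono (he j).2
  · exact pullback_sum _ _ _
  · refine Finset.sum_congr rfl fun j _ => ?_
    rw [transportChart_target]
    refine MeasureTheory.setIntegral_congr_fun (e j).open_target.measurableSet fun x hx => ?_
    have hx' : x ∈ (transportChart μ (e j)).target := by rwa [transportChart_target]
    have h2 := coeff_pullback μ.symm (transportChart_mem μ (he j).1) (α j : TopForm n M) hx'
    have h3 : transportChart μ.symm (transportChart μ (e j)) = e j :=
      transportChart_transportChart_symm μ.symm (e j)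
    rw [h3] at h2
    change _ = _ * coeff _ (SmoothingKernels.pullback μ.symm (α j : TopForm n M)) x
    rw [frameSign_transportChart hμ (he j).1 hx, h2]

/-- The possible values of the integral of a form and of its pullback are the same, so no
uniqueness of the value is needed. -/
theorem integral_pullback {oM : MOrientation n M} {oN : MOrientation n N}
    {μ : M ≃ₘ^∞⟮𝓡 n, 𝓡 n⟯ N} (hμ : OrientationPreserving oM oN μ) (η : TopForm n N) :
    integral oM (pullback μ η) = integral oN η := by
  have h : HasIntegral oM (pullback μ η) = HasIntegral oN η := by
    funext s
    refine propext ⟨fun h => ?_, HasIntegral.pullback hμ⟩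
    have := h.pullback_symm hμ
    rwa [pullback_symm_pullback] at this
  unfold integral
  rw [h]

end Integral

/-! ### Smooth curves of forms -/

section Curves

variable {n : ℕ} {M N : Type*} [TopologicalSpace M] [ChartedSpace (Model n) M]
  [IsManifold (𝓡 n) ∞ M] [TopologicalSpace N] [ChartedSpace (Model n) N] [IsManifold (𝓡 n) ∞ N]
  (μ : M ≃ₘ^∞⟮𝓡 n, 𝓡 n⟯ N)

/-- The pullback `Ωⁿ_c(N) → Ωⁿ_c(M)` by a diffeomorphism, as a linear map. -/
def pullbackLin : ↥(CForm n N) →ₗ[ℝ] ↥(CForm n M) where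
  toFun := pullbackC μ
  map_add' _ _ := rfl
  map_smul' _ _ := rfl

/-- The pullback `Ωⁿ_c(N) → Ωⁿ_c(M)` by a diffeomorphism is continuous. -/
theorem IsContinuousSeminorm.comp_pullback {p : Seminorm ℝ (CForm n M)}
    (hp : IsContinuousSeminorm p) : IsContinuousSeminorm (M := N)
      (Seminorm.comp (E := CForm n N) (E₂ := CForm n M) p (pullbackLin μ)) := by
  intro K hK
  obtain ⟨m, e, L, j, C, he, h⟩ := hp (μ ⁻¹' K) (μ.toHomeomorph.isCompact_preimage.2 hK)
  refine ⟨m, fun i => transportChart μ (e i), L, j, C, fun i => ⟨transportChart_mem μ (he i).1,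
    (he i).2.1, ?_⟩, fun η r hη hr hb => ?_⟩
  · rw [transportChart_target]
    exact (he i).2.2
  · refine h (pullbackC μ η) r ?_ hr fun i x hx => ?_
    · change supp (pullback μ (η : TopForm n N)) ⊆ _
      rw [supp_pullback]
      exact Set.preimage_mono hη
    · have hev : coeff (e i) (pullbackC μ η : TopForm n M) =ᶠ[𝓝 x]
          coeff (transportChart μ (e i)) (η : TopForm n N) := by
        filter_upwards [(e i).open_target.mem_nhds ((he i).2.2 hx)] with y hy
        exact coeff_pullback μ (he i).1 _ hy
      rw [(hev.iteratedFDeriv ℝ (j i)).eq_of_nhds]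
      exact hb i x hx

theorem IsSmoothCurve.pullbackC {c : ℝ → CForm n N} (hc : IsSmoothCurve c) :
    IsSmoothCurve fun t => pullbackC μ (c t) := by
  obtain ⟨d, rfl, hd⟩ := hc
  refine ⟨fun k t => SmoothingKernels.pullbackC μ (d k t), rfl, fun k t p hp => ?_⟩
  exact hd k t _ (hp.comp_pullback μ)

theorem IsSmoothKernelMap.pullback {Φ : KernelMap n N} (hΦ : IsSmoothKernelMap Φ) :
    IsSmoothKernelMap fun ε p => SmoothingKernels.pullbackC μ (Φ ε (μ p)) :=
  fun a γ ha hγ => (hΦ a (fun t => μ (γ t)) ha (μ.contMDiff.comp hγ)).pullbackC μ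

end Curves

/-! ### Related vector fields, local flows and Lie derivatives -/

section Flow

variable {n : ℕ} {M N : Type*} [TopologicalSpace M] [ChartedSpace (Model n) M]
  [IsManifold (𝓡 n) ∞ M] [TopologicalSpace N] [ChartedSpace (Model n) N] [IsManifold (𝓡 n) ∞ N]

/-- The vector fields `X` on `M` and `Y` on `N` are `μ`-related: `Tμ ∘ X = Y ∘ μ`. -/
def VRelated (μ : M ≃ₘ^∞⟮𝓡 n, 𝓡 n⟯ N) (X : VField n M) (Y : VField n N) : Prop :=
  ∀ p, mfderiv (𝓡 n) (𝓡 n) μ p (X p) = Y (μ p)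

/-- The push-forward of a vector field along a diffeomorphism, defined as the pullback along the
inverse. -/
def pushField (μ : M ≃ₘ^∞⟮𝓡 n, 𝓡 n⟯ N) (X : VField n M) : VField n N where
  toFun := VectorField.mpullback (𝓡 n) (𝓡 n) μ.symm X
  contMDiff_toFun := X.contMDiff.mpullback_vectorField (n := ∞) μ.symm.contMDiff
    (fun x => ⟨μ.symm.mfderivToContinuousLinearEquiv (by simp) x, rfl⟩) (by simp)

theorem VRelated.symm {μ : M ≃ₘ^∞⟮𝓡 n, 𝓡 n⟯ N} {X : VField n M} {Y : VField n N}
    (h : VRelated μ X Y) : VRelated μ.symm Y X := by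
  intro q
  obtain ⟨p, rfl⟩ := μ.surjective q
  refine ((congrArg (fun v => mfderiv (𝓡 n) (𝓡 n) μ.symm (μ p) v) (h p)).symm.trans
    (mfderiv_symm_mfderiv μ p _)).trans ?_
  exact (congrArg (fun r => (show Model n from X r)) (μ.symm_apply_apply p)).symm

theorem vRelated_pushField (μ : M ≃ₘ^∞⟮𝓡 n, 𝓡 n⟯ N) (X : VField n M) :
    VRelated μ X (pushField μ X) := by
  have h : VRelated μ.symm (pushField μ X) X := fun q => by
    change mfderiv (𝓡 n) (𝓡 n) μ.symm q
      ((μ.symm.mfderivToContinuousLinearEquiv (by simp) q : TangentSpace (𝓡 n) q →L[ℝ]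
        TangentSpace (𝓡 n) (μ.symm q)).inverse (X (μ.symm q))) = _
    rw [ContinuousLinearMap.inverse_equiv]
    exact (μ.symm.mfderivToContinuousLinearEquiv (by simp) q).apply_symm_apply _
  exact h.symm

theorem VRelated.comp_integralCurve {μ : M ≃ₘ^∞⟮𝓡 n, 𝓡 n⟯ N} {X : VField n M}
    {Y : VField n N} (h : VRelated μ X Y) {γ : ℝ → M} {s : Set ℝ}
    (hγ : IsMIntegralCurveOn (I := 𝓡 n) γ (fun x => X x) s) :
    IsMIntegralCurveOn (I := 𝓡 n) (fun t => μ (γ t)) (fun x => Y x) s := by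
  intro t ht
  have h1 := (μ.contMDiff.mdifferentiable (by simp) (γ t)).hasMFDerivAt.comp_hasMFDerivWithinAt t
    (hγ t ht)
  have h2 : (mfderiv (𝓡 n) (𝓡 n) μ (γ t)).comp ((1 : ℝ →L[ℝ] ℝ).smulRight (X (γ t))) =
      (1 : ℝ →L[ℝ] ℝ).smulRight (Y (μ (γ t))) := by
    rw [← h (γ t)]
    ext
    simp
  exact h2 ▸ h1

theorem VRelated.isLocalFlow {μ : M ≃ₘ^∞⟮𝓡 n, 𝓡 n⟯ N} {X : VField n M} {Y : VField n N}
    (h : VRelated μ X Y) {q : M} {F : ℝ → M → M} (hF : IsLocalFlow X q F) :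
    IsLocalFlow Y (μ q) fun t p => μ (F t (μ.symm p)) := by
  obtain ⟨δ, U, hδ, hU, hq, hs, hc⟩ := hF
  refine ⟨δ, μ.symm ⁻¹' U, hδ, hU.preimage μ.symm.continuous, by simpa using hq, ?_,
    fun p hp => ⟨?_, h.comp_integralCurve (hc _ hp).2⟩⟩
  · refine μ.contMDiff.comp_contMDiffOn (hs.comp (t := Set.Ioo (-δ) δ ×ˢ U)
      (f := fun z : ℝ × N => (z.1, μ.symm z.2)) ?_ fun z hz => hz)
    exact (contMDiff_fst.prodMk (μ.symm.contMDiff.comp contMDiff_snd)).contMDiffOn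
  · change μ (F 0 (μ.symm p)) = p
    rw [(hc _ hp).1, μ.apply_symm_apply]

/-- Two local flows of the same vector field have the same germ at every small time, by uniqueness
of integral curves. -/
theorem IsLocalFlow.eventuallyEq [T2Space M] {X : VField n M} {q : M} {F G : ℝ → M → M}
    (hF : IsLocalFlow X q F) (hG : IsLocalFlow X q G) :
    ∀ᶠ t in 𝓝 (0 : ℝ), F t =ᶠ[𝓝 q] G t := by
  obtain ⟨δ, U, hδ, hU, hq, -, hc⟩ := hF
  obtain ⟨δ', U', hδ', hU', hq', -, hc'⟩ := hG
  have hm : 0 < min δ δ' := lt_min hδ hδ'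
  filter_upwards [Ioo_mem_nhds (neg_lt_zero.2 hm) hm] with t ht
  filter_upwards [hU.mem_nhds hq, hU'.mem_nhds hq'] with p hp hp'
  refine isMIntegralCurveOn_Ioo_eqOn_of_contMDiff_boundaryless (I := 𝓡 n) (t₀ := 0)
    (v := fun x => X x) ⟨neg_lt_zero.2 hm, hm⟩ (X.contMDiff.of_le (by simp))
    ((hc p hp).2.mono ?_) ((hc' p hp').2.mono ?_) ?_ ht
  · exact Set.Ioo_subset_Ioo (neg_le_neg (min_le_left _ _)) (min_le_left _ _)
  · exact Set.Ioo_subset_Ioo (neg_le_neg (min_le_right _ _)) (min_le_right _ _)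
  · rw [(hc p hp).1, (hc' p hp').1]

/-- A diffeomorphism intertwines the local flows of related vector fields. `localFlow` is a choice
among all local flows; uniqueness of their germs makes the choice irrelevant. -/
theorem VRelated.localFlow [T2Space N] {μ : M ≃ₘ^∞⟮𝓡 n, 𝓡 n⟯ N} {X : VField n M}
    {Y : VField n N} (h : VRelated μ X Y) (q : M) : ∀ᶠ t in 𝓝 (0 : ℝ),
      (fun p => μ (localFlow X q t p)) =ᶠ[𝓝 q] fun p => localFlow Y (μ q) t (μ p) := by
  by_cases hX : ∃ F, IsLocalFlow X q F
  · have hY : ∃ F, IsLocalFlow Y (μ q) F := ⟨_, h.isLocalFlow hX.choose_spec⟩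
    have h1 := (h.isLocalFlow hX.choose_spec).eventuallyEq hY.choose_spec
    simp only [SmoothingKernels.localFlow, dif_pos hX, dif_pos hY]
    filter_upwards [h1] with t ht
    filter_upwards [μ.continuous.continuousAt.eventually ht] with p hp
    simpa using hp
  -- Without a local flow on one side there is none on the other, and both defaults are constant
  -- in time.
  · have hY : ¬ ∃ F, IsLocalFlow Y (μ q) F := fun ⟨F, hF⟩ => hX (by
      have := h.symm.isLocalFlow hF
      rw [μ.symm_apply_apply] at this
      exact ⟨_, this⟩)
    simp only [SmoothingKernels.localFlow, dif_neg hX, dif_neg hY]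
    exact Filter.Eventually.of_forall fun _ => Filter.EventuallyEq.rfl

/-- Each map of a local flow is differentiable at the base point for small times. -/
theorem mdifferentiableAt_localFlow (X : VField n M) (q : M) :
    ∀ᶠ t in 𝓝 (0 : ℝ), MDifferentiableAt (𝓡 n) (𝓡 n) (localFlow X q t) q := by
  by_cases hX : ∃ F, IsLocalFlow X q F
  · simp only [localFlow, dif_pos hX]
    obtain ⟨δ, U, hδ, hU, hq, hs, -⟩ := hX.choose_spec
    filter_upwards [Ioo_mem_nhds (neg_lt_zero.2 hδ) hδ] with t ht
    have h1 := hs.contMDiffAt ((isOpen_Ioo.prod hU).mem_nhds (Set.mk_mem_prod ht hq))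
    have h2 : ContMDiffAt (𝓡 n) (𝓡 n) ∞ (fun p => hX.choose t p) q :=
      h1.comp q (contMDiffAt_const.prodMk contMDiffAt_id)
    exact h2.mdifferentiableAt (by simp)
  · simp only [localFlow, dif_neg hX]
    exact Filter.Eventually.of_forall fun _ => mdifferentiableAt_id

theorem lieDeriv_pullback [T2Space N] {μ : M ≃ₘ^∞⟮𝓡 n, 𝓡 n⟯ N} {X : VField n M}
    {Y : VField n N} (h : VRelated μ X Y) (η : TopForm n N) :
    lieDeriv X (pullback μ η) = pullback μ (lieDeriv Y η) := by
  funext q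
  rw [← pullbackEquiv_apply, lieDeriv, lieDeriv, ← deriv_pullbackEquiv]
  refine deriv_congr_covector ?_
  filter_upwards [h.localFlow q, mdifferentiableAt_localFlow X q,
    mdifferentiableAt_localFlow Y (μ q)] with t ht hX hY
  rw [pullbackEquiv_apply, pullback_pullback_apply hX (μ.contMDiff.mdifferentiable (by simp) _),
    pullback_pullback_apply (μ.contMDiff.mdifferentiable (by simp) _) hY]
  exact pullback_congr ht η

/-- The transport of a two-point form depending on `ε` by a diffeomorphism, in both points. -/
def pullTwo (μ : M ≃ₘ^∞⟮𝓡 n, 𝓡 n⟯ N) (Φ : Set.Ioc (0 : ℝ) 1 → N → TopForm n N) :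
    Set.Ioc (0 : ℝ) 1 → M → TopForm n M :=
  fun ε p => pullback μ (Φ ε (μ p))

theorem lieTwo_pullTwo [T2Space N] {μ : M ≃ₘ^∞⟮𝓡 n, 𝓡 n⟯ N} {X : VField n M}
    {Y : VField n N} (h : VRelated μ X Y) (Φ : Set.Ioc (0 : ℝ) 1 → N → TopForm n N) :
    lieTwo X (pullTwo μ Φ) = pullTwo μ (lieTwo Y Φ) := by
  funext ε p
  exact lieDeriv_pullback h _

theorem lieTwo'_pullTwo [T2Space N] {μ : M ≃ₘ^∞⟮𝓡 n, 𝓡 n⟯ N} {X : VField n M}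
    {Y : VField n N} (h : VRelated μ X Y) (Φ : Set.Ioc (0 : ℝ) 1 → N → TopForm n N) :
    lieTwo' X (pullTwo μ Φ) = pullTwo μ (lieTwo' Y Φ) := by
  funext ε p q
  rw [pullTwo, ← pullbackEquiv_apply, lieTwo', lieTwo', ← deriv_pullbackEquiv]
  refine deriv_congr_covector ?_
  filter_upwards [h.localFlow p] with t ht
  rw [pullbackEquiv_apply, pullTwo, ht.eq_of_nhds]

theorem iterLie_pullTwo [T2Space N] (μ : M ≃ₘ^∞⟮𝓡 n, 𝓡 n⟯ N) (θ ζ : List (VField n M))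
    (Φ : Set.Ioc (0 : ℝ) 1 → N → TopForm n N) :
    iterLie θ ζ (pullTwo μ Φ) =
      pullTwo μ (iterLie (θ.map (pushField μ)) (ζ.map (pushField μ)) Φ) := by
  have hadd : ∀ A B : Set.Ioc (0 : ℝ) 1 → N → TopForm n N,
      pullTwo μ (A + B) = pullTwo μ A + pullTwo μ B := fun _ _ => rfl
  have hζ : ∀ ζ : List (VField n M), ζ.foldr (fun X Ψ => lieTwo' X Ψ + lieTwo X Ψ) (pullTwo μ Φ) =
      pullTwo μ ((ζ.map (pushField μ)).foldr (fun X Ψ => lieTwo' X Ψ + lieTwo X Ψ) Φ) := by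
    intro ζ
    induction ζ with
    | nil => rfl
    | cons X ζ ih =>
      rw [List.foldr_cons, ih, lieTwo'_pullTwo (vRelated_pushField μ X),
        lieTwo_pullTwo (vRelated_pushField μ X), List.map_cons, List.foldr_cons, hadd]
  rw [iterLie, iterLie, hζ]
  induction θ with
  | nil => rfl
  | cons X θ ih =>
    rw [List.foldr_cons, ih, lieTwo_pullTwo (vRelated_pushField μ X), List.map_cons,
      List.foldr_cons]

end Flow

/-! ### Pullback of Riemannian metrics -/

section Metric

variable {n : ℕ} {M N : Type*} [TopologicalSpace M] [ChartedSpace (Model n) M]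
  [IsManifold (𝓡 n) ∞ M] [TopologicalSpace N] [ChartedSpace (Model n) N] [IsManifold (𝓡 n) ∞ N]

/-- The inner product of the pulled back metric `μ^*g` at `p`. -/
def pullbackInner (μ : M ≃ₘ^∞⟮𝓡 n, 𝓡 n⟯ N) (g : RMetric n N) (p : M) :
    TangentSpace (𝓡 n) p →L[ℝ] TangentSpace (𝓡 n) p →L[ℝ] ℝ :=
  (ContinuousLinearMap.precomp ℝ (mfderiv (𝓡 n) (𝓡 n) μ p)).comp
    ((g.inner (μ p)).comp (mfderiv (𝓡 n) (𝓡 n) μ p))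

omit [IsManifold (𝓡 n) ∞ M] in
theorem pullbackInner_apply (μ : M ≃ₘ^∞⟮𝓡 n, 𝓡 n⟯ N) (g : RMetric n N) (p : M)
    (v w : TangentSpace (𝓡 n) p) : pullbackInner μ g p v w =
      g.inner (μ p) (mfderiv (𝓡 n) (𝓡 n) μ p v) (mfderiv (𝓡 n) (𝓡 n) μ p w) := rfl

/-- The coordinate expression of a tangent map, read back through the trivialization of the target,
is the tangent map itself. -/
theorem symm_inTangentCoordinates_mfderiv {f : M → N} {p₀ p : M}
    (hp : p ∈ (trivializationAt (Model n) (TangentSpace (𝓡 n)) p₀).baseSet)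
    (hp' : f p ∈ (trivializationAt (Model n) (TangentSpace (𝓡 n)) (f p₀)).baseSet) (u : Model n) :
    (trivializationAt (Model n) (TangentSpace (𝓡 n)) (f p₀)).symm (f p)
      (inTangentCoordinates (𝓡 n) (𝓡 n) id f (mfderiv (𝓡 n) (𝓡 n) f) p₀ p u) =
      mfderiv (𝓡 n) (𝓡 n) f p
        ((trivializationAt (Model n) (TangentSpace (𝓡 n)) p₀).symm p u) := by
  have h := congrArg (fun L => L u) (ContinuousLinearMap.inCoordinates_eq
    (F := Model n) (F' := Model n)
    (E := fun q : M => TangentSpace (𝓡 n) q) (E' := fun q : N => TangentSpace (𝓡 n) q)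
    (x₀ := p₀) (y₀ := f p₀) (ϕ := mfderiv (𝓡 n) (𝓡 n) f p) hp hp')
  have h' := congrArg ((trivializationAt (Model n) (TangentSpace (𝓡 n)) (f p₀)).symm (f p)) h
  refine h'.trans ?_
  exact ((trivializationAt (Model n) (fun q : N => TangentSpace (𝓡 n) q)
    (f p₀)).continuousLinearEquivAt ℝ (f p) hp').symm_apply_apply _

theorem contMDiff_pullbackInner (μ : M ≃ₘ^∞⟮𝓡 n, 𝓡 n⟯ N) (g : RMetric n N) :
    ContMDiff (𝓡 n) ((𝓡 n).prod 𝓘(ℝ, Model n →L[ℝ] Model n →L[ℝ] ℝ)) ∞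
      (fun p => Bundle.TotalSpace.mk' (Model n →L[ℝ] Model n →L[ℝ] ℝ)
        (E := fun p : M => TangentSpace (𝓡 n) p →L[ℝ] TangentSpace (𝓡 n) p →L[ℝ] ℝ)
        p (pullbackInner μ g p)) := by
  intro p₀
  rw [contMDiffAt_hom_bundle]
  refine ⟨contMDiffAt_id, ?_⟩
  have hG := ((contMDiffAt_hom_bundle _).1 (g.contMDiff (μ p₀))).2.comp p₀ μ.contMDiff.contMDiffAt
  have hA := (μ.contMDiff.contMDiffAt (x := p₀)).mfderiv_const (m := ∞) (by simp)
  -- In coordinates the Gram map of `μ^*g` is `v ↦ (G (A v)) ∘ A`.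
  have hC : ContDiff ℝ ∞ fun z : (Model n →L[ℝ] Model n →L[ℝ] ℝ) × (Model n →L[ℝ] Model n) =>
      ((ContinuousLinearMap.compL ℝ (Model n) (Model n) ℝ).flip z.2).comp (z.1.comp z.2) :=
    ((ContinuousLinearMap.compL ℝ (Model n) (Model n) ℝ).flip.contDiff.comp contDiff_snd).clm_comp
      (contDiff_fst.clm_comp contDiff_snd)
  refine (hC.contMDiff.contMDiffAt.comp p₀ (hG.prodMk_space hA)).congr_of_eventuallyEq ?_
  have hM : (trivializationAt (Model n) (TangentSpace (𝓡 n)) p₀).baseSet ∈ 𝓝 p₀ :=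
    (trivializationAt _ _ _).open_baseSet.mem_nhds (FiberBundle.mem_baseSet_trivializationAt' _)
  have hN : μ ⁻¹' (trivializationAt (Model n) (TangentSpace (𝓡 n)) (μ p₀)).baseSet ∈ 𝓝 p₀ :=
    μ.continuous.continuousAt.preimage_mem_nhds
      ((trivializationAt _ _ _).open_baseSet.mem_nhds (FiberBundle.mem_baseSet_trivializationAt' _))
  filter_upwards [hM, hN] with p hp hp'
  ext v w
  have hp'' : μ p ∈ (trivializationAt (Model n) (TangentSpace (𝓡 n)) (μ p₀)).baseSet := hp'
  have key := symm_inTangentCoordinates_mfderiv (f := μ) hp hp''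
  rw [inCoordinates_apply_eq₂ hp hp (Set.mem_univ _)]
  change _ = ContinuousLinearMap.inCoordinates (Model n) (fun q : N => TangentSpace (𝓡 n) q)
    (Model n →L[ℝ] ℝ) (fun q : N => TangentSpace (𝓡 n) q →L[ℝ] ℝ) (μ p₀) (μ p) (μ p₀) (μ p)
    (g.inner (μ p))
    (inTangentCoordinates (𝓡 n) (𝓡 n) id μ (mfderiv (𝓡 n) (𝓡 n) μ) p₀ p v)
    (inTangentCoordinates (𝓡 n) (𝓡 n) id μ (mfderiv (𝓡 n) (𝓡 n) μ) p₀ p w)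
  rw [inCoordinates_apply_eq₂ hp'' hp'' (Set.mem_univ _), key, key]
  rfl

/-- The pullback `μ^*g` of a Riemannian metric by a diffeomorphism. -/
def pullbackMetric (μ : M ≃ₘ^∞⟮𝓡 n, 𝓡 n⟯ N) (g : RMetric n N) : RMetric n M where
  inner := pullbackInner μ g
  symm p v w := g.symm _ _ _
  pos p v hv := g.pos _ _ fun h => hv
    ((μ.mfderivToContinuousLinearEquiv (by simp) p).map_eq_zero_iff.1 h)
  isVonNBounded p := by
    refine ((g.isVonNBounded (μ p)).image
      ((μ.mfderivToContinuousLinearEquiv (by simp) p).symm :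
        TangentSpace (𝓡 n) (μ p) →L[ℝ] TangentSpace (𝓡 n) p)).subset fun v hv => ?_
    exact ⟨mfderiv (𝓡 n) (𝓡 n) μ p v, hv,
      (μ.mfderivToContinuousLinearEquiv (by simp) p).symm_apply_apply v⟩
  contMDiff := contMDiff_pullbackInner μ g

theorem formNorm_pullback (μ : M ≃ₘ^∞⟮𝓡 n, 𝓡 n⟯ N) (g : RMetric n N) (η : TopForm n N) (p : M) :
    formNorm (pullbackMetric μ g) (pullback μ η p) = formNorm g (η (μ p)) := by
  let L := μ.mfderivToContinuousLinearEquiv (by simp) p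
  refine Equiv.iSup_congr ((Equiv.piCongrRight fun _ => L.toEquiv).subtypeEquiv fun v => ?_)
    fun v => ?_
  · exact Iff.rfl
  · rfl

open scoped Bundle in
theorem enorm_eq_ofReal_sqrt_inner (g : RMetric n M) {p : M} (v : TangentSpace (𝓡 n) p) :
    (letI : Bundle.RiemannianBundle (fun x : M => TangentSpace (𝓡 n) x) := ⟨g.toRiemannianMetric⟩;
      ‖v‖ₑ) = ENNReal.ofReal √(g.inner p v v) := by
  let _ : Bundle.RiemannianBundle (fun x : M => TangentSpace (𝓡 n) x) := ⟨g.toRiemannianMetric⟩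
  have h : ‖v‖ = √(g.inner p v v) := norm_eq_sqrt_real_inner v
  rw [← h]
  exact (ofReal_norm v).symm

open scoped Bundle in
/-- The `g`-distance of the images of two points is at most their `μ^*g`-distance, since `μ` maps
curves to curves of the same length. -/
theorem riemannianEDist_map_le (μ : M ≃ₘ^∞⟮𝓡 n, 𝓡 n⟯ N) (g : RMetric n N) (p q : M) :
    (letI : Bundle.RiemannianBundle (fun x : N => TangentSpace (𝓡 n) x) := ⟨g.toRiemannianMetric⟩;
      Manifold.riemannianEDist (𝓡 n) (μ p) (μ q)) ≤
    (letI : Bundle.RiemannianBundle (fun x : M => TangentSpace (𝓡 n) x) :=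
        ⟨(pullbackMetric μ g).toRiemannianMetric⟩;
      Manifold.riemannianEDist (𝓡 n) p q) := by
  let _ : Bundle.RiemannianBundle (fun x : N => TangentSpace (𝓡 n) x) := ⟨g.toRiemannianMetric⟩
  let _ : Bundle.RiemannianBundle (fun x : M => TangentSpace (𝓡 n) x) :=
    ⟨(pullbackMetric μ g).toRiemannianMetric⟩
  refine le_of_forall_gt fun r hr => ?_
  obtain ⟨γ, h0, h1, hγ, hl⟩ := Manifold.exists_lt_of_riemannianEDist_lt hr
  refine (Manifold.riemannianEDist_le_pathELength (γ := μ ∘ γ) (a := 0) (b := 1)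
    ((μ.contMDiff.of_le (by simp)).comp_contMDiffOn hγ) (by simp [h0]) (by simp [h1])
    zero_le_one).trans_lt (hl.trans_le' ?_)
  rw [Manifold.pathELength_eq_lintegral_mfderiv_Ioo, Manifold.pathELength_eq_lintegral_mfderiv_Ioo]
  refine MeasureTheory.setLIntegral_mono' measurableSet_Ioo fun t ht => le_of_eq ?_
  have hd : MDifferentiableAt 𝓘(ℝ, ℝ) (𝓡 n) γ t :=
    (hγ.contMDiffAt (Icc_mem_nhds ht.1 ht.2)).mdifferentiableAt (by simp)
  rw [mfderiv_comp t (μ.contMDiff.mdifferentiable (by simp) _) hd]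
  refine (enorm_eq_ofReal_sqrt_inner g _).trans (Eq.trans ?_
    (enorm_eq_ofReal_sqrt_inner (pullbackMetric μ g) _).symm)
  exact congrArg (fun x => ENNReal.ofReal √x) (pullbackInner_apply μ g (γ t) _ _).symm

theorem preimage_metricBall_subset (μ : M ≃ₘ^∞⟮𝓡 n, 𝓡 n⟯ N) (g : RMetric n N) (p : M) (r : ℝ) :
    metricBall (pullbackMetric μ g) p r ⊆ μ ⁻¹' metricBall g (μ p) r :=
  fun q hq => (riemannianEDist_map_le μ g p q).trans_lt hq

end Metric

/-! ### Transport of smoothing kernels -/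

section Transport

variable {n : ℕ} {M N : Type*} [TopologicalSpace M] [ChartedSpace (Model n) M]
  [IsManifold (𝓡 n) ∞ M] [TopologicalSpace N] [ChartedSpace (Model n) N] [IsManifold (𝓡 n) ∞ N]

/-- The bounds for a metric `g` on `M` are those of `Φ` for the push-forward `(μ⁻¹)^*g` of `g`. -/
theorem IsSmoothingKernel.pullback [T2Space N] {oM : MOrientation n M} {oN : MOrientation n N}
    {μ : M ≃ₘ^∞⟮𝓡 n, 𝓡 n⟯ N} (hμ : OrientationPreserving oM oN μ) {Φ : KernelMap n N}
    (hΦ : IsSmoothingKernel oN Φ) : IsSmoothingKernel oM fun ε p => pullbackC μ (Φ ε (μ p)) where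
  smooth := hΦ.smooth.pullback μ
  mem_unitForms ε p := (integral_pullback hμ _).trans (hΦ.mem_unitForms ε (μ p))
  supp_subset g K hK := by
    obtain ⟨ε₀, hε₀, C, hC, h⟩ := hΦ.supp_subset (pullbackMetric μ.symm g) (μ '' K)
      (hK.image μ.continuous)
    refine ⟨ε₀, hε₀, C, hC, fun p hp ε hε => ?_⟩
    change supp (SmoothingKernels.pullback μ (Φ ε (μ p) : TopForm n N)) ⊆ _
    rw [supp_pullback]
    intro q hq
    have h1 := preimage_metricBall_subset μ.symm g _ _ (h _ (Set.mem_image_of_mem μ hp) ε hε hq)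
    rwa [Set.mem_preimage, μ.symm_apply_apply, μ.symm_apply_apply] at h1
  growth g K hK θ ζ := by
    obtain ⟨ε₀, hε₀, C, hC, h⟩ := hΦ.growth (pullbackMetric μ.symm g) (μ '' K)
      (hK.image μ.continuous) (θ.map (pushField μ)) (ζ.map (pushField μ))
    refine ⟨ε₀, hε₀, C, hC, fun ε hε p hp q => ?_⟩
    have h1 := h ε hε _ (Set.mem_image_of_mem μ hp) (μ q)
    have h2 := iterLie_pullTwo μ θ ζ fun ε p => (Φ ε p : TopForm n N)
    change formNorm g (iterLie θ ζ (pullTwo μ fun ε p => (Φ ε p : TopForm n N)) ε p q) ≤ _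
    rw [h2, pullTwo]
    generalize iterLie (θ.map (pushField μ)) (ζ.map (pushField μ))
      (fun ε p => (Φ ε p : TopForm n N)) ε (μ p) = η at h1 ⊢
    rw [← pullback_symm_pullback μ η, formNorm_pullback, μ.symm_apply_apply, List.length_map] at h1
    exact h1

theorem kernelSpace.pullback [T2Space N] {oM : MOrientation n M} {oN : MOrientation n N}
    {μ : M ≃ₘ^∞⟮𝓡 n, 𝓡 n⟯ N} (hμ : OrientationPreserving oM oN μ) {k : ℕ} {Φ : KernelMap n N}
    (hΦ : Φ ∈ kernelSpace oN k) : (fun ε p => pullbackC μ (Φ ε (μ p))) ∈ kernelSpace oM k := by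
  refine ⟨hΦ.1.pullback hμ, fun hk f hf K hK => ?_⟩
  obtain ⟨ε₀, hε₀, C, hC, h⟩ := hΦ.2 hk (fun q => f (μ.symm q)) (hf.comp μ.symm.contMDiff)
    (μ '' K) (hK.image μ.continuous)
  refine ⟨ε₀, hε₀, C, hC, fun ε hε p hp => ?_⟩
  have h1 := h ε hε _ (Set.mem_image_of_mem μ hp)
  rw [← integral_pullback hμ, μ.symm_apply_apply] at h1
  convert h1 using 5 with q
  change f q • SmoothingKernels.pullback μ (Φ ε (μ p) : TopForm n N) q =
    (f (μ.symm (μ q)) • (Φ ε (μ p) : TopForm n N) (μ q)).compContinuousLinearMap _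
  rw [μ.symm_apply_apply]
  rfl

end Transport

end SmoothingKernels

end

theorem mainTheorem4 {n : ℕ}
    {M : Type*} [TopologicalSpace M] [T2Space M] [ParacompactSpace M]
    [ChartedSpace (EuclideanSpace ℝ (Fin n)) M] [IsManifold (𝓡 n) ∞ M]
    {N : Type*} [TopologicalSpace N] [T2Space N] [ParacompactSpace N]
    [ChartedSpace (EuclideanSpace ℝ (Fin n)) N] [IsManifold (𝓡 n) ∞ N]
    (oM : SmoothingKernels.MOrientation n M) (oN : SmoothingKernels.MOrientation n N)
    (μ : M ≃ₘ^∞⟮𝓡 n, 𝓡 n⟯ N) (hμ : SmoothingKernels.OrientationPreserving oM oN μ)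
    (k : ℕ) (Φ : SmoothingKernels.KernelMap n N)
    (hΦ : Φ ∈ SmoothingKernels.kernelSpace oN k) :
    (fun ε p => SmoothingKernels.pullbackC μ (Φ ε (μ p))) ∈
      SmoothingKernels.kernelSpace oM k := by
  exact SmoothingKernels.kernelSpace.pullback hμ hΦ
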